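/- For a number field $K$ with ring of integers $\mathcal{O}_K$, and for a prime $p$ and an integer $f \ge 1$, let $\Pi_{p^f}(K)$ be the product of all maximal ideals of $\mathcal{O}_K$ of norm $p^f$ (the unit ideal if there are none). The Pólya group $Po(K)$ is the subgroup of the ideal class group of $K$ generated by the classes of all the ideals $\Pi_{p^f}(K)$, and $K$ is a Pólya field if all the $\Pi_{p^f}(K)$ are principal, i.e. if $Po(K)$ is trivial. Below, $\left(\frac{a}{p}\right)$ denotes the Legendre symbol. Let $p_1, p_2, p_3, q_1, q_2$ be distinct prime numbers with $p_1 \equiv p_2 \equiv q_1 \equiv q_2 \equiv 3 \pmod 4$ and $p_3 \equiv 1 \pmod 4$, such that $q_1q_2 \equiv p_1p_2p_3 \equiv 1 \pmod 8$, and let $K = \mathbb{Q}(\sqrt{q_1q_2}, \sqrt{p_1p_2p_3})$. Then $K$ is a Pólya field in each of the following cases. 1. $\left(\frac{p_1}{p_2}\right) = 1$, $\left(\frac{p_1}{p_3}\right) = 1$, $\left(\frac{p_2}{p_3}\right) = -1$, $\left(\frac{p_3}{q_1}\right) = \left(\frac{p_3}{q_2}\right) = \left(\frac{p_1}{q_1}\right)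 = \left(\frac{p_1}{q_2}\right) = -1$ and $\left(\frac{q_1q_2}{p_2}\right) = -1$. 2. $\left(\frac{p_1}{p_2}\right) = 1$, $\left(\frac{p_1}{p_3}\right) = -1$, $\left(\frac{p_2}{p_3}\right) = 1$, $\left(\frac{p_3}{q_1}\right) = \left(\frac{p_3}{q_2}\right) = -\left(\frac{p_1}{q_1}\right) = -\left(\frac{p_1}{q_2}\right) = -1$ and $\left(\frac{q_1q_2}{p_2}\right) = -1$. 3. $\left(\frac{p_1}{p_3}\right) = -1$, $\left(\frac{p_2}{p_3}\right) = -1$, $\left(\frac{p_3}{q_1}\right) = -\left(\frac{p_3}{q_2}\right) = 1$ and $\left(\frac{p_1p_2}{q_1}\right) = \left(\frac{p_1p_2}{q_2}\right) = -\left(\frac{q_1q_2}{p_1}\right) = -1$. 4. $\left(\frac{p_1}{p_2}\right) = -1$, $\left(\frac{p_1}{p_3}\right) = 1$, $\left(\frac{p_2}{p_3}\right) = -1$, $\left(\frac{p_3}{q_1}\right) = \left(\frac{p_3}{q_2}\right) = -1$ and $\left(\frac{p_1p_2}{q_1}\right) = \left(\frac{p_1p_2}{q_2}\right) = -\left(\frac{q_1q_2}{p_1}\right)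 = 1$. 5. $\left(\frac{p_1}{p_2}\right) = -1$, $\left(\frac{p_1}{p_3}\right) = -1$, $\left(\frac{p_2}{p_3}\right) = 1$, $\left(\frac{p_3}{q_1}\right) = \left(\frac{p_3}{q_2}\right) = \left(\frac{p_1}{q_1}\right) = \left(\frac{p_1}{q_2}\right) = -1$ and $\left(\frac{q_1q_2}{p_2}\right) = -1$. Moreover, if $\left(\frac{p_1}{p_3}\right) = \left(\frac{p_2}{p_3}\right) = 1$, then either $K$ is a Pólya field or $Po(K) \simeq \mathbb{Z}/2\mathbb{Z}$. -/

import Mathlib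

open NumberField nonZeroDivisors

noncomputable section

/-- The (finite) set of maximal ideals of `𝓞 K` of absolute norm `q`. -/
def maximalIdealsOfNorm (K : Type*) [Field K] [NumberField K] (q : ℕ) :
    Finset (Ideal (𝓞 K)) :=
  ((Ideal.finite_setOfPred_absNorm_eq (S := 𝓞 K) q).subset
    (fun _ hm => hm.2 : {m : Ideal (𝓞 K) | m.IsMaximal ∧ Ideal.absNorm m = q} ⊆ _)).toFinset

theorem mem_maximalIdealsOfNorm {K : Type*} [Field K] [NumberField K] {q : ℕ}
    {m : Ideal (𝓞 K)} :
    m ∈ maximalIdealsOfNorm K q ↔ m.IsMaximal ∧ Ideal.absNorm m = q := by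
  simp [maximalIdealsOfNorm]

/-- The Ostrowski ideal `Π_q(K)`: the product of all maximal ideals of `𝓞 K` of norm `q`
(the unit ideal if there are none). It is used for prime powers `q = p ^ f`, `f ≥ 1`. -/
def ostrowskiIdeal (K : Type*) [Field K] [NumberField K] (q : ℕ) : Ideal (𝓞 K) :=
  ∏ m ∈ maximalIdealsOfNorm K q, m

theorem ostrowskiIdeal_mem_nonZeroDivisors (K : Type*) [Field K] [NumberField K] (q : ℕ) :
    ostrowskiIdeal K q ∈ (Ideal (𝓞 K))⁰ := by
  rw [mem_nonZeroDivisors_iff_ne_zero, ostrowskiIdeal, Finset.prod_ne_zero_iff]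
  intro m hm h0
  have hmax := (mem_maximalIdealsOfNorm.mp hm).1
  subst h0
  exact RingOfIntegers.not_isField K (Ring.isField_iff_maximal_bot.mpr hmax)

/-- The Pólya group `Po(K)`: the subgroup of the ideal class group generated by the classes of
all Ostrowski ideals `Π_{p^f}(K)`, `p` prime, `f ≥ 1`. -/
def polyaGroup (K : Type*) [Field K] [NumberField K] : Subgroup (ClassGroup (𝓞 K)) :=
  Subgroup.closure {c | ∃ p f : ℕ, p.Prime ∧ 1 ≤ f ∧
    c = ClassGroup.mk0 ⟨ostrowskiIdeal K (p ^ f), ostrowskiIdeal_mem_nonZeroDivisors K (p ^ f)⟩}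

/-- `K` is a Pólya field if all its Ostrowski ideals `Π_{p^f}(K)` are principal. -/
def IsPolyaField (K : Type*) [Field K] [NumberField K] : Prop :=
  ∀ p f : ℕ, p.Prime → 1 ≤ f → (ostrowskiIdeal K (p ^ f)).IsPrincipal

/-- `K` is a Pólya field if and only if its Pólya group is trivial. -/
theorem isPolyaField_iff (K : Type*) [Field K] [NumberField K] :
    IsPolyaField K ↔ polyaGroup K = ⊥ := by
  rw [polyaGroup, Subgroup.closure_eq_bot_iff]
  constructor
  · rintro h c ⟨p, f, hp, hf, rfl⟩
    exact (ClassGroup.mk0_eq_one_iff _).mpr (h p f hp hf)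
  · intro h p f hp hf
    exact (ClassGroup.mk0_eq_one_iff _).mp (h ⟨p, f, hp, hf, rfl⟩)

end

/-
The Pólya group of a biquadratic field is generated by the classes of the products of the primes
above the ramified rational primes `p`; these products are square roots of `(p)`, so the classes
have order at most two. For `d = q₁q₂`, `p₁p₂p₃` and their product, `√d ∈ K` relates the classes of
the primes dividing `d`. Halving the fundamental solution of `x² - dy² = 1` gives a further
relation: a factorization `d = rs`, `r ≠ 1`, with `r a² = s b² + 1`, which makes the product of the
classes of the primes dividing `r` trivial. The first two values of `d` leave at most one class,
of order at most two. In each of the listed cases, reducing `r a² = s b² + 1` modulo the primes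
dividing `d` and applying quadratic reciprocity leaves only factorizations of the third value
that kill this class as well.
-/

section Pell

theorem exists_eq_mul_sq_of_coprime_of_mul_eq {d u v w : ℕ} (hd : d ≠ 0) (huv : u.Coprime v)
    (h : u * v = d * w ^ 2) :
    ∃ r s a b : ℕ, r * s = d ∧ u = r * a ^ 2 ∧ v = s * b ^ 2 := by
  have hrs : d.gcd u * d.gcd v = d := by
    rw [← huv.gcd_mul]
    exact Nat.gcd_eq_left ⟨_, h⟩
  obtain ⟨u', hu'⟩ := Nat.gcd_dvd_right d u
  obtain ⟨v', hv'⟩ := Nat.gcd_dvd_right d v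
  have hw : u' * v' = w ^ 2 := by
    refine Nat.eq_of_mul_eq_mul_left (Nat.pos_of_ne_zero hd) ?_
    calc d * (u' * v') = (d.gcd u * u') * (d.gcd v * v') := by rw [mul_mul_mul_comm, hrs]
      _ = d * w ^ 2 := by rw [← hu', ← hv', h]
  have hcop : u'.Coprime v' :=
    (huv.coprime_dvd_left ⟨_, hu'.trans (mul_comm _ _)⟩).coprime_dvd_right
      ⟨_, hv'.trans (mul_comm _ _)⟩
  obtain ⟨a, ha⟩ := exists_eq_pow_of_mul_eq_pow (Nat.isUnit_iff.mpr hcop) hw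
  obtain ⟨b, hb⟩ :=
    exists_eq_pow_of_mul_eq_pow (Nat.isUnit_iff.mpr hcop.symm) ((mul_comm _ _).trans hw)
  exact ⟨_, _, a, b, hrs, by rw [← ha]; exact hu', by rw [← hb]; exact hv'⟩

theorem odd_and_even_of_sq_eq_mul_sq_add_one {d x y : ℕ} (hd : d % 4 = 1)
    (h : x ^ 2 = d * y ^ 2 + 1) : Odd x ∧ Even y := by
  have h4 : x ^ 2 % 4 = (y ^ 2 + 1) % 4 := by
    rw [h, Nat.add_mod, Nat.mul_mod, hd, one_mul, Nat.mod_mod, ← Nat.add_mod]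
  have hsq_even {n : ℕ} (hn : Even n) : n ^ 2 % 4 = 0 := by
    obtain ⟨m, rfl⟩ := hn.two_dvd
    rw [mul_pow]
    exact Nat.mul_mod_right _ _
  have hsq_odd {n : ℕ} (hn : Odd n) : n ^ 2 % 4 = 1 := by
    have := Int.sq_mod_four_eq_one_of_odd (x := n) (by exact_mod_cast hn)
    exact_mod_cast this
  rcases Nat.even_or_odd x with hx | hx <;> rcases Nat.even_or_odd y with hy | hy
  · have := hsq_even hx; have := hsq_even hy; omega
  · have := hsq_even hx; have := hsq_odd hy; omega
  · exact ⟨hx, hy⟩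
  · have := hsq_odd hx; have := hsq_odd hy; omega

/- Halving the fundamental solution `(2 * v + 1, 2 * w)` gives coprime `v + 1` and `v` with product
`d * w ^ 2`; a factorization with `r = 1` would be a smaller solution. -/
theorem exists_mul_sq_eq_mul_sq_add_one {d : ℕ} (hd : d % 4 = 1) (hsq : ¬ IsSquare d) :
    ∃ r s a b : ℕ, r * s = d ∧ r ≠ 1 ∧ r * a ^ 2 = s * b ^ 2 + 1 := by
  obtain ⟨z, hx1, hy0, hmin⟩ := Pell.IsFundamental.exists_of_not_isSquare (d := (d : ℤ)) (by omega)
    (by rwa [Int.isSquare_natCast_iff])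
  have hzp := z.prop
  obtain ⟨x, hx⟩ := Int.eq_ofNat_of_zero_le (zero_le_one.trans hx1.le)
  obtain ⟨y, hy⟩ := Int.eq_ofNat_of_zero_le hy0.le
  have hxy : x ^ 2 = d * y ^ 2 + 1 := by
    rw [hx, hy] at hzp
    zify
    linarith
  obtain ⟨⟨v, rfl⟩, heven⟩ := odd_and_even_of_sq_eq_mul_sq_add_one hd hxy
  obtain ⟨w, rfl⟩ := heven.two_dvd
  obtain ⟨r, s, a, b, hrs, hu, hv⟩ := exists_eq_mul_sq_of_coprime_of_mul_eq
    (d := d) (w := w) (by rintro rfl; omega) (by simp : (v + 1).Coprime v) (by linarith)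
  have hab : r * a ^ 2 = s * b ^ 2 + 1 := by rw [← hu, ← hv]
  refine ⟨r, s, a, b, hrs, ?_, hab⟩
  rintro rfl
  obtain rfl : s = d := by simpa using hrs
  have hsol : (a : ℤ) ^ 2 - s * (b : ℤ) ^ 2 = 1 := by
    zify at hab
    linarith
  have hvpos : 0 < v := by
    rw [hx] at hx1
    omega
  have ha : 1 < a := by
    by_contra! ha
    have : a ^ 2 ≤ 1 := by nlinarith
    linarith
  have hva : 2 * v + 1 ≤ a := by
    have := hmin (b := Pell.Solution₁.mk a b hsol) (by simpa using ha)
    rw [hx, Pell.Solution₁.x_mk] at this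
    exact_mod_cast this
  nlinarith [hvpos]

variable {p r s a b : ℕ} [Fact p.Prime]

theorem legendreSym_eq_one_of_mul_sq_eq_of_dvd_right (h : r * a ^ 2 = s * b ^ 2 + 1) (hs : p ∣ s) :
    legendreSym p r = 1 := by
  have h' : (r * a ^ 2 : ZMod p) = s * b ^ 2 + 1 := by exact_mod_cast congrArg Nat.cast h
  rw [(ZMod.natCast_eq_zero_iff s p).mpr hs, zero_mul, zero_add] at h'
  have hr : ((r : ℤ) : ZMod p) ≠ 0 := by
    rw [Int.cast_natCast]
    exact left_ne_zero_of_mul_eq_one h'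
  refine legendreSym.eq_one_of_sq_sub_mul_sq_eq_zero' (x := (1 : ZMod p)) (y := a) hr one_ne_zero ?_
  rw [Int.cast_natCast, h', one_pow, sub_self]

theorem legendreSym_neg_eq_one_of_mul_sq_eq_of_dvd_left (h : r * a ^ 2 = s * b ^ 2 + 1)
    (hr : p ∣ r) : legendreSym p (-s) = 1 := by
  have h' : (r * a ^ 2 : ZMod p) = s * b ^ 2 + 1 := by exact_mod_cast congrArg Nat.cast h
  rw [(ZMod.natCast_eq_zero_iff r p).mpr hr, zero_mul] at h'
  have hs' : ((-s : ℤ) : ZMod p) * b ^ 2 = 1 := by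
    push_cast
    linear_combination h'
  refine legendreSym.eq_one_of_sq_sub_mul_sq_eq_zero' (x := (1 : ZMod p)) (y := b)
    (left_ne_zero_of_mul_eq_one hs') one_ne_zero ?_
  rw [hs', one_pow, sub_self]

end Pell

/-- `T` is a Pell splitting of `S` if `r * a ^ 2 - s * b ^ 2 = 1` is solvable in natural numbers,
where `r` is the product of the elements of `T` and `s` that of the remaining elements of `S`. For a
set `S` of primes, halving the fundamental solution of `x ^ 2 - (∏ p ∈ S, p) * y ^ 2 = 1` yields
one. -/
structure IsPellSplitting (S T : Finset ℕ) : Prop where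
  subset : T ⊆ S
  exists_mul_sq_eq : ∃ a b : ℕ, (∏ p ∈ T, p) * a ^ 2 = (∏ p ∈ S \ T, p) * b ^ 2 + 1

theorem exists_isPellSplitting {S : Finset ℕ} (hS : ∀ p ∈ S, p.Prime) (hne : S.Nonempty)
    (hmod : (∏ p ∈ S, p) % 4 = 1) : ∃ T, T.Nonempty ∧ IsPellSplitting S T := by
  have hsf : Squarefree (∏ p ∈ S, p) := Finset.squarefree_prod_of_pairwise_isCoprime
    (fun p hp q hq hpq => Nat.coprime_iff_isRelPrime.mp
      ((Nat.coprime_primes (hS p hp) (hS q hq)).mpr hpq)) fun p hp => (hS p hp).squarefree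
  have hsq : ¬ IsSquare (∏ p ∈ S, p) := by
    rintro ⟨c, hc⟩
    obtain ⟨p, hp⟩ := hne
    have hpc : p ∣ c * c := hc ▸ Finset.dvd_prod_of_mem _ hp
    rw [Nat.isUnit_iff.mp (hsf c ⟨1, by rw [hc, mul_one]⟩), mul_one] at hpc
    exact (hS p hp).ne_one (Nat.dvd_one.mp hpc)
  obtain ⟨r, s, a, b, hrs, hr1, h⟩ := exists_mul_sq_eq_mul_sq_add_one hmod hsq
  rw [← hrs] at hsf
  have hr := Nat.prod_primeFactors_of_squarefree hsf.of_mul_left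
  have hs := Nat.prod_primeFactors_of_squarefree hsf.of_mul_right
  have hcop : r.Coprime s := Nat.coprime_of_squarefree_mul hsf
  have hS' : S = r.primeFactors ∪ s.primeFactors := by
    rw [← hcop.primeFactors_mul, hrs, Nat.primeFactors_prod hS]
  have hdiff : S \ r.primeFactors = s.primeFactors := by
    rw [hS', Finset.union_sdiff_cancel_left hcop.disjoint_primeFactors]
  refine ⟨r.primeFactors, ?_, hS' ▸ Finset.subset_union_left, a, b, by rw [hdiff, hr, hs, h]⟩
  rw [Finset.nonempty_iff_ne_empty]
  intro h0
  rw [h0, Finset.prod_empty] at hr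
  exact hr1 hr.symm

namespace IsPellSplitting

variable {S T : Finset ℕ} {p : ℕ} [Fact p.Prime]

theorem prod_legendreSym_eq (hT : IsPellSplitting S T) (hp : p ∈ S) :
    ∏ q ∈ S, (if q ∈ T ↔ p ∈ T then 1 else legendreSym p q) =
      if p ∈ T then legendreSym p (-1) else 1 := by
  obtain ⟨a, b, h⟩ := hT.exists_mul_sq_eq
  have hsplit (U : Finset ℕ) :
      ∏ q ∈ U, legendreSym p q = legendreSym p ((∏ q ∈ U, q : ℕ) : ℤ) := by
    rw [Nat.cast_prod]
    exact (map_prod (legendreSym.hom p) _ U).symm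
  by_cases hpT : p ∈ T
  · have h1 := legendreSym_neg_eq_one_of_mul_sq_eq_of_dvd_left h (Finset.dvd_prod_of_mem _ hpT)
    rw [neg_eq_neg_one_mul, legendreSym.mul, ← hsplit] at h1
    simp only [hpT, iff_true, if_true]
    rw [Int.eq_of_mul_eq_one h1, Finset.sdiff_eq_filter, Finset.prod_filter]
    simp only [ite_not]
  · have h1 := legendreSym_eq_one_of_mul_sq_eq_of_dvd_right h
      (Finset.dvd_prod_of_mem _ (Finset.mem_sdiff.mpr ⟨hp, hpT⟩))
    simp only [hpT, iff_false, if_false, ite_not]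
    rw [Finset.prod_ite_mem, Finset.inter_eq_right.mpr hT.subset, hsplit, h1]

theorem prod_legendreSym_eq_of_mod_four_eq_three (hT : IsPellSplitting S T) (hp : p ∈ S)
    (hp4 : p % 4 = 3) :
    ∏ q ∈ S, (if q ∈ T ↔ p ∈ T then 1 else legendreSym p q) = if p ∈ T then -1 else 1 := by
  rw [hT.prod_legendreSym_eq hp, legendreSym.at_neg_one (by rintro rfl; omega),
    ZMod.χ₄_nat_three_mod_four hp4]

theorem prod_legendreSym_eq_of_mod_four_eq_one (hT : IsPellSplitting S T) (hp : p ∈ S)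
    (hp4 : p % 4 = 1) :
    ∏ q ∈ S, (if q ∈ T ↔ p ∈ T then 1 else legendreSym p q) = 1 := by
  rw [hT.prod_legendreSym_eq hp, legendreSym.at_neg_one (by rintro rfl; omega),
    ZMod.χ₄_nat_one_mod_four hp4, ite_self]

theorem exists_notMem_of_mod_four_eq_three (hT : IsPellSplitting S T) (hp : p ∈ S)
    (hp4 : p % 4 = 3) : ∃ q ∈ S, q ∉ T := by
  by_contra! hST
  have h := hT.prod_legendreSym_eq_of_mod_four_eq_three hp hp4
  rw [Finset.prod_eq_one fun q hq => if_pos (iff_of_true (hST q hq) (hST p hp)),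
    if_pos (hST p hp)] at h
  norm_num at h

end IsPellSplitting

section PrimesOver

theorem even_of_isSquare_pow_of_squarefree {M : Type*} [CommMonoidWithZero M] [Nontrivial M]
    [UniqueFactorizationMonoid M] {x : M} {n : ℕ} (hx : Squarefree x) (hu : ¬ IsUnit x)
    (h : IsSquare (x ^ n)) : Even n := by
  obtain ⟨y, hy⟩ := h
  obtain ⟨q, hq, hqx⟩ := WfDvdMonoid.exists_irreducible_factor hu hx.ne_zero
  have hx1 : emultiplicity q x = 1 :=
    le_antisymm (((squarefree_iff_emultiplicity_le_one x).mp hx q).resolve_right hq.not_isUnit)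
      (by simpa using le_emultiplicity_of_pow_dvd (k := 1) (by rwa [pow_one]))
  have hn : (n : ℕ∞) = emultiplicity q y + emultiplicity q y := by
    rw [← emultiplicity_mul hq.prime, ← hy, emultiplicity_pow hq.prime, hx1, mul_one]
  have htop : emultiplicity q y ≠ ⊤ := by
    intro htop
    simp [htop] at hn
  lift emultiplicity q y to ℕ using htop with k
  exact ⟨k, by exact_mod_cast hn⟩

variable (K : Type*) [Field K] [NumberField K] (p : ℕ)

/-- The product of the prime ideals of `𝓞 K` above `p`. -/
noncomputable def prodPrimesOver : Ideal (𝓞 K) :=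
  ∏ P ∈ IsDedekindDomain.primesOverFinset (Ideal.span {(p : ℤ)}) (𝓞 K), P

variable {K p}

theorem prime_of_mem_primesOverFinset {P : Ideal (𝓞 K)}
    (hP : P ∈ IsDedekindDomain.primesOverFinset (Ideal.span {(p : ℤ)}) (𝓞 K)) : Prime P :=
  UniqueFactorizationMonoid.prime_of_factor _ (Multiset.mem_toFinset.mp hP)

variable (K p) in
theorem squarefree_prodPrimesOver : Squarefree (prodPrimesOver K p) :=
  Finset.squarefree_prod_of_pairwise_isCoprime (f := fun P => P)
    (fun _ hP _ hQ hPQ =>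
      have hP' := prime_of_mem_primesOverFinset hP
      have hQ' := prime_of_mem_primesOverFinset hQ
      hP'.irreducible.isRelPrime_iff_not_dvd.mpr fun h =>
        hPQ (associated_iff_eq.mp (hP'.associated_of_dvd hQ' h)))
    fun _ hP => (prime_of_mem_primesOverFinset hP).irreducible.squarefree

variable [Fact p.Prime]

theorem span_natCast_ne_bot : Ideal.span {(p : ℤ)} ≠ ⊥ := by
  simpa using (Fact.out : p.Prime).ne_zero

theorem mem_primesOverFinset_span_natCast {P : Ideal (𝓞 K)} :
    P ∈ IsDedekindDomain.primesOverFinset (Ideal.span {(p : ℤ)}) (𝓞 K) ↔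
      P ∈ (Ideal.span {(p : ℤ)}).primesOver (𝓞 K) :=
  IsDedekindDomain.mem_primesOverFinset_iff span_natCast_ne_bot _

theorem not_isUnit_prodPrimesOver : ¬ IsUnit (prodPrimesOver K p) := by
  obtain ⟨P, hP⟩ := (inferInstance : Nonempty ((Ideal.span {(p : ℤ)}).primesOver (𝓞 K)))
  have hP' := mem_primesOverFinset_span_natCast.mpr hP
  exact fun h => (prime_of_mem_primesOverFinset hP').not_isUnit
    (isUnit_of_dvd_unit (Finset.dvd_prod_of_mem (fun P => P) hP') h)

theorem mem_primesOver_of_absNorm_eq_pow {P : Ideal (𝓞 K)} {f : ℕ} (hP : P.IsMaximal)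
    (h : P.absNorm = p ^ f) : P ∈ (Ideal.span {(p : ℤ)}).primesOver (𝓞 K) := by
  refine ⟨hP.isPrime, ⟨(Int.ideal_span_isMaximal_of_prime p).eq_of_le
    (Ideal.IsPrime.under ℤ P).ne_top ?_⟩⟩
  rw [Ideal.span_singleton_le_iff_mem, Ideal.mem_comap, map_natCast]
  refine hP.isPrime.mem_of_pow_mem f ?_
  rw [← Nat.cast_pow, ← h]
  exact Ideal.absNorm_mem P

variable [IsGalois ℚ K]

variable (K p) in
theorem span_eq_prodPrimesOver_pow : Ideal.span {(p : 𝓞 K)} =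
    prodPrimesOver K p ^ (Ideal.span {(p : ℤ)}).ramificationIdxIn (𝓞 K) := by
  have h := Ideal.map_algebraMap_eq_finsetProd_pow (R := 𝓞 K) (span_natCast_ne_bot (p := p))
  rw [Ideal.map_span, Set.image_singleton, map_natCast] at h
  rw [h, prodPrimesOver, ← Finset.prod_pow]
  refine Finset.prod_congr (by ext P; rw [Set.mem_toFinset, mem_primesOverFinset_span_natCast])
    fun P hP => ?_
  obtain ⟨_, _⟩ := mem_primesOverFinset_span_natCast.mp hP
  rw [Ideal.ramificationIdxIn_eq_ramificationIdx (Ideal.span {(p : ℤ)}) P Gal(K/ℚ)]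

theorem absNorm_of_mem_primesOver {P : Ideal (𝓞 K)}
    (hP : P ∈ (Ideal.span {(p : ℤ)}).primesOver (𝓞 K)) :
    P.absNorm = p ^ (Ideal.span {(p : ℤ)}).inertiaDegIn (𝓞 K) := by
  have := Ideal.isMaximal_of_mem_primesOver hP
  obtain ⟨_, _⟩ := hP
  rw [Ideal.absNorm_eq_pow_inertiaDeg' P (Fact.out : p.Prime), Ideal.inertiaDeg'_eq_inertiaDeg,
    Ideal.inertiaDegIn_eq_inertiaDeg (Ideal.span {(p : ℤ)}) P Gal(K/ℚ)]

variable (K p) in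
theorem ostrowskiIdeal_eq_one_or_eq_prodPrimesOver (f : ℕ) :
    ostrowskiIdeal K (p ^ f) = 1 ∨ ostrowskiIdeal K (p ^ f) = prodPrimesOver K p := by
  by_cases hf : (Ideal.span {(p : ℤ)}).inertiaDegIn (𝓞 K) = f
  · right
    refine Finset.prod_congr ?_ fun _ _ => rfl
    ext P
    rw [mem_maximalIdealsOfNorm, mem_primesOverFinset_span_natCast]
    exact ⟨fun h => mem_primesOver_of_absNorm_eq_pow h.1 h.2, fun h =>
      ⟨Ideal.isMaximal_of_mem_primesOver h, by
        rw [absNorm_of_mem_primesOver h, hf]⟩⟩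
  · left
    refine Finset.prod_eq_one fun P hP => ?_
    obtain ⟨hmax, hnorm⟩ := mem_maximalIdealsOfNorm.mp hP
    rw [absNorm_of_mem_primesOver (mem_primesOver_of_absNorm_eq_pow hmax hnorm)] at hnorm
    exact absurd (Nat.pow_right_injective (Fact.out : p.Prime).two_le hnorm) hf

end PrimesOver

theorem exists_integer_sq_eq_natCast {K : Type*} [Field K] {α : K} {d : ℕ} (h : α ^ 2 = d) :
    ∃ a : 𝓞 K, a ^ 2 = d := by
  have hα : IsIntegral ℤ α := IsIntegral.of_pow two_pos (by rw [h]; exact isIntegral_natCast _)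
  exact ⟨⟨α, hα⟩, RingOfIntegers.coe_injective (by rw [map_natCast, ← h]; rfl)⟩

section Ramification

section Field

variable {F L : Type*} [Field F] [Field L] [Algebra F L] {s : Set L}

open Polynomial in
theorem isGalois_of_adjoin_sqrt_eq_top [CharZero F] (hs : IntermediateField.adjoin F s = ⊤)
    (h : ∀ x ∈ s, ∃ d : F, x ^ 2 = algebraMap F L d) : IsGalois F L := by
  have hsplits : ∀ x ∈ s, IsIntegral F x ∧ ((minpoly F x).map (algebraMap F L)).Splits := by
    intro x hx
    obtain ⟨d, hd⟩ := h x hx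
    have hx : IsIntegral F x := IsIntegral.of_pow two_pos (hd ▸ isIntegral_algebraMap)
    have hdvd : minpoly F x ∣ X ^ 2 - C d := minpoly.dvd F x (by simp [hd])
    have hmap : (X ^ 2 - C d).map (algebraMap F L) = (X - C x) * (X - C (-x)) := by
      rw [Polynomial.map_sub, Polynomial.map_pow, map_X, map_C, ← hd, map_neg, map_pow]
      ring
    refine ⟨hx, Splits.of_dvd ((Splits.X_sub_C x).mul (Splits.X_sub_C (-x))) ?_
      (hmap ▸ Polynomial.map_dvd _ hdvd)⟩
    exact mul_ne_zero (X_sub_C_ne_zero _) (X_sub_C_ne_zero _)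
  have : Algebra.IsAlgebraic F (⊤ : IntermediateField F L) :=
    hs ▸ IntermediateField.isAlgebraic_adjoin fun x hx => (hsplits x hx).1
  have : Algebra.IsAlgebraic F L := IntermediateField.topEquiv.isAlgebraic
  have : Normal F L :=
    ⟨fun x => IntermediateField.splits_of_mem_adjoin F L hsplits (hs ▸ IntermediateField.mem_top)⟩
  exact {}

theorem algEquiv_ext_of_adjoin_eq_top (hs : IntermediateField.adjoin F s = ⊤)
    {σ τ : L ≃ₐ[F] L} (h : ∀ x ∈ s, σ x = τ x) : σ = τ := by
  have h' := IntermediateField.algHom_ext_of_eq_adjoin F (K := L) hs.symm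
    (φ₁ := (σ : L →ₐ[F] L).comp (IntermediateField.val ⊤))
    (φ₂ := (τ : L →ₐ[F] L).comp (IntermediateField.val ⊤)) fun x hx => h x hx
  ext x
  exact DFunLike.congr_fun h' (⟨x, trivial⟩ : (⊤ : IntermediateField F L))

end Field

variable {K : Type*} [Field K] [NumberField K] {α : K} {d p : ℕ}

theorem algEquiv_apply_eq_or_eq_neg (hα : α ^ 2 = d) (σ : Gal(K/ℚ)) : σ α = α ∨ σ α = -α := by
  rw [← sq_eq_sq_iff_eq_or_eq_neg, ← map_pow, hα, map_natCast]

theorem isIntegral_one_add_div_two (hα : α ^ 2 = d) (hd : d % 4 = 1) :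
    IsIntegral ℤ ((1 + α) / 2) := by
  obtain ⟨m, rfl⟩ : ∃ m, d = 4 * m + 1 := ⟨d / 4, by omega⟩
  refine ⟨Polynomial.X ^ 2 - Polynomial.X - Polynomial.C (m : ℤ), by monicity!, ?_⟩
  push_cast at hα
  simp only [algebraMap_int_eq, map_natCast, Polynomial.eval₂_sub, Polynomial.eval₂_X_pow,
    Polynomial.eval₂_X, Polynomial.eval₂_natCast]
  linear_combination hα / 4

theorem inertia_apply_sqrt_eq (hα : α ^ 2 = d) (hd : d % 4 = 1) (hpd : ¬ p ∣ d)
    {P : Ideal (𝓞 K)} [P.LiesOver (Ideal.span {(p : ℤ)})] {σ : Gal(K/ℚ)}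
    (hσ : σ ∈ P.inertia Gal(K/ℚ)) : σ α = α := by
  refine (algEquiv_apply_eq_or_eq_neg hα σ).resolve_right fun hneg => hpd ?_
  obtain ⟨ω, hω⟩ : ∃ ω : 𝓞 K, (ω : K) = (1 + α) / 2 := ⟨⟨_, isIntegral_one_add_div_two hα hd⟩, rfl⟩
  have hsub : ((σ • ω - ω : 𝓞 K) : K) = -α := by
    change σ ω - ω = -α
    rw [hω, map_div₀, map_add, hneg, map_one, map_ofNat]
    ring
  have hmem : ((d : ℤ) : 𝓞 K) ∈ P := by
    have hsq : ((d : ℤ) : 𝓞 K) = (σ • ω - ω) ^ 2 :=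
      RingOfIntegers.coe_injective (by simp [-map_sub, hsub, hα])
    exact hsq ▸ P.pow_mem_of_mem (hσ ω) 2 two_pos
  have hover : (d : ℤ) ∈ Ideal.span {(p : ℤ)} := by
    rw [Ideal.mem_of_liesOver P]
    exact hmem
  exact_mod_cast Ideal.mem_span_singleton.mp hover

variable [Fact p.Prime] {s : Set K}

variable (K p) in
theorem exists_card_inertia_eq_ramificationIdxIn [IsGalois ℚ K] :
    ∃ P : Ideal (𝓞 K), P.LiesOver (Ideal.span {(p : ℤ)}) ∧
      Nat.card (P.inertia Gal(K/ℚ)) = (Ideal.span {(p : ℤ)}).ramificationIdxIn (𝓞 K) := by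
  obtain ⟨P, _, hP⟩ := (inferInstance : Nonempty ((Ideal.span {(p : ℤ)}).primesOver (𝓞 K)))
  exact ⟨P, hP, Ideal.card_inertia_eq_ramificationIdxIn (Ideal.span {(p : ℤ)}) P⟩

theorem ramificationIdxIn_eq_one_of_adjoin_sqrt_eq_top (hs : IntermediateField.adjoin ℚ s = ⊤)
    (h : ∀ x ∈ s, ∃ d : ℕ, x ^ 2 = d ∧ d % 4 = 1 ∧ ¬ p ∣ d) :
    (Ideal.span {(p : ℤ)}).ramificationIdxIn (𝓞 K) = 1 := by
  have : IsGalois ℚ K := isGalois_of_adjoin_sqrt_eq_top hs fun x hx => by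
    obtain ⟨d, hd, -⟩ := h x hx
    exact ⟨d, by simpa using hd⟩
  obtain ⟨P, _, hP⟩ := exists_card_inertia_eq_ramificationIdxIn K p
  rw [← hP, Subgroup.card_eq_one, Subgroup.eq_bot_iff_forall]
  refine fun σ hσ => algEquiv_ext_of_adjoin_eq_top hs fun x hx => ?_
  obtain ⟨d, hd, hd4, hpd⟩ := h x hx
  exact inertia_apply_sqrt_eq hd hd4 hpd hσ

theorem ramificationIdxIn_le_two_of_adjoin_insert_sqrt_eq_top
    (hs : IntermediateField.adjoin ℚ (insert α s) = ⊤) (hα : α ^ 2 = d)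
    (h : ∀ x ∈ s, ∃ d : ℕ, x ^ 2 = d ∧ d % 4 = 1 ∧ ¬ p ∣ d) :
    (Ideal.span {(p : ℤ)}).ramificationIdxIn (𝓞 K) ≤ 2 := by
  have : IsGalois ℚ K := isGalois_of_adjoin_sqrt_eq_top hs fun x hx => by
    obtain rfl | hx := hx
    · exact ⟨d, by simpa using hα⟩
    · obtain ⟨d, hd, -⟩ := h x hx
      exact ⟨d, by simpa using hd⟩
  obtain ⟨P, _, hP⟩ := exists_card_inertia_eq_ramificationIdxIn K p
  rw [← hP]
  let conj : P.inertia Gal(K/ℚ) → ({α, -α} : Set K) :=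
    fun σ => ⟨σ.1 α, algEquiv_apply_eq_or_eq_neg hα σ.1⟩
  have hconj : Function.Injective conj := fun σ τ hστ =>
    Subtype.ext <| algEquiv_ext_of_adjoin_eq_top hs fun x hx => by
      obtain rfl | hx := hx
      · exact Subtype.ext_iff.mp hστ
      · obtain ⟨d, hd, hd4, hpd⟩ := h x hx
        rw [inertia_apply_sqrt_eq hd hd4 hpd σ.2, inertia_apply_sqrt_eq hd hd4 hpd τ.2]
  exact (Nat.card_le_card_of_injective conj hconj).trans
    ((Set.ncard_insert_le _ _).trans (by rw [Set.ncard_singleton]))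

theorem isRelPrime_span_natCast {R : Type*} [CommRing R] {m n : ℕ}
    (h : m.Coprime n) : IsRelPrime (Ideal.span {(m : R)}) (Ideal.span {(n : R)}) :=
  ((Ideal.isCoprime_span_singleton_iff _ _).mpr
    (by simpa using (Nat.isCoprime_iff_coprime.mpr h).map (Int.castRingHom R))).isRelPrime

theorem even_ramificationIdxIn_of_dvd [IsGalois ℚ K] (hα : α ^ 2 = d) (hd : Squarefree d)
    (hpd : p ∣ d) : Even ((Ideal.span {(p : ℤ)}).ramificationIdxIn (𝓞 K)) := by
  obtain ⟨m, rfl⟩ := hpd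
  obtain ⟨a, ha⟩ := exists_integer_sq_eq_natCast hα
  have hmul : Ideal.span {(p : 𝓞 K)} * Ideal.span {(m : 𝓞 K)} = Ideal.span {a} ^ 2 := by
    rw [Ideal.span_singleton_mul_span_singleton, ← Nat.cast_mul, ← ha, Ideal.span_singleton_pow]
  have hrel := isRelPrime_span_natCast (R := 𝓞 K) (Nat.coprime_of_squarefree_mul hd)
  obtain ⟨J, hJ⟩ := exists_eq_pow_of_mul_eq_pow (gcd_isUnit_iff_isRelPrime.mpr hrel) hmul
  refine even_of_isSquare_pow_of_squarefree (squarefree_prodPrimesOver K p)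
    not_isUnit_prodPrimesOver ⟨J, ?_⟩
  rw [← span_eq_prodPrimesOver_pow, hJ, sq]

end Ramification

/-- `K = ℚ(√d₁, √d₂)` with `α = √d₁` and `β = √d₂`, where `d₁` and `d₂` are coprime, squarefree
and congruent to `1` modulo `4`, so that a prime ramifies in `K` exactly when it divides `d₁ * d₂`.
-/
structure IsBiquadratic {K : Type*} [Field K] [NumberField K] (d₁ d₂ : ℕ) (α β : K) : Prop where
  sq_left : α ^ 2 = d₁
  sq_right : β ^ 2 = d₂
  adjoin_eq_top : IntermediateField.adjoin ℚ {α, β} = ⊤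
  mod_four_left : d₁ % 4 = 1
  mod_four_right : d₂ % 4 = 1
  squarefree_mul : Squarefree (d₁ * d₂)

namespace IsBiquadratic

variable {K : Type*} [Field K] [NumberField K] {d₁ d₂ p : ℕ} {α β : K}

theorem symm (h : IsBiquadratic d₁ d₂ α β) : IsBiquadratic d₂ d₁ β α where
  sq_left := h.sq_right
  sq_right := h.sq_left
  adjoin_eq_top := Set.pair_comm α β ▸ h.adjoin_eq_top
  mod_four_left := h.mod_four_right
  mod_four_right := h.mod_four_left
  squarefree_mul := mul_comm d₁ d₂ ▸ h.squarefree_mul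

theorem isGalois (h : IsBiquadratic d₁ d₂ α β) : IsGalois ℚ K :=
  isGalois_of_adjoin_sqrt_eq_top h.adjoin_eq_top <| by
    rintro x (rfl | rfl)
    exacts [⟨d₁, by simpa using h.sq_left⟩, ⟨d₂, by simpa using h.sq_right⟩]

variable [Fact p.Prime]

theorem span_eq_prodPrimesOver_of_not_dvd (h : IsBiquadratic d₁ d₂ α β) (hp : ¬ p ∣ d₁ * d₂) :
    Ideal.span {(p : 𝓞 K)} = prodPrimesOver K p := by
  have := h.isGalois
  have hram := ramificationIdxIn_eq_one_of_adjoin_sqrt_eq_top (p := p) h.adjoin_eq_top <| by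
    rintro x (rfl | rfl)
    exacts [⟨d₁, h.sq_left, h.mod_four_left, fun hd => hp (hd.mul_right _)⟩,
      ⟨d₂, h.sq_right, h.mod_four_right, fun hd => hp (hd.mul_left _)⟩]
  rw [span_eq_prodPrimesOver_pow, hram, pow_one]

theorem prodPrimesOver_sq_of_dvd_left (h : IsBiquadratic d₁ d₂ α β) (hp : p ∣ d₁) :
    prodPrimesOver K p ^ 2 = Ideal.span {(p : 𝓞 K)} := by
  have := h.isGalois
  have hle := ramificationIdxIn_le_two_of_adjoin_insert_sqrt_eq_top (p := p) h.adjoin_eq_top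
    h.sq_left <| by
      rintro x rfl
      exact ⟨d₂, h.sq_right, h.mod_four_right, fun hd => (Fact.out : p.Prime).not_isUnit
        (h.squarefree_mul p (mul_dvd_mul hp hd))⟩
  have hne := Ideal.ramificationIdxIn_ne_zero Gal(K/ℚ) (B := 𝓞 K) (p := Ideal.span {(p : ℤ)})
  obtain ⟨k, hk⟩ := even_ramificationIdxIn_of_dvd h.sq_left h.squarefree_mul.of_mul_left hp
  rw [span_eq_prodPrimesOver_pow]
  exact congrArg (prodPrimesOver K p ^ ·) (by omega)

theorem prodPrimesOver_sq_of_dvd (h : IsBiquadratic d₁ d₂ α β) (hp : p ∣ d₁ * d₂) :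
    prodPrimesOver K p ^ 2 = Ideal.span {(p : 𝓞 K)} :=
  ((Fact.out : p.Prime).dvd_mul.mp hp).elim h.prodPrimesOver_sq_of_dvd_left
    h.symm.prodPrimesOver_sq_of_dvd_left

end IsBiquadratic

section Classes

theorem isPrincipal_of_sq_eq_span {R : Type*} [CommRing R] [IsDedekindDomain R] {J : Ideal R}
    {c r : R} (h : Associated (c ^ 2) r) (hJ : J ^ 2 = Ideal.span {r}) : J.IsPrincipal := by
  rw [← Ideal.span_singleton_eq_span_singleton.mpr h, ← Ideal.span_singleton_pow] at hJ
  exact ⟨c, pow_left_injective two_ne_zero hJ⟩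

/- The element `r * a + b * δ` is `√r * (a * √r + b * √s)`, and the second factor is a unit with
inverse `a * √r - b * √s`. -/
theorem associated_sq_of_mul_sq_eq {R : Type*} [CommRing R] {δ r s a b : R}
    (hδ : δ ^ 2 = r * s) (h : r * a ^ 2 = s * b ^ 2 + 1) :
    Associated ((r * a + b * δ) ^ 2) r := by
  have hunit : (r * a ^ 2 + s * b ^ 2 + 2 * a * b * δ) *
      (r * a ^ 2 + s * b ^ 2 - 2 * a * b * δ) = 1 := by
    linear_combination (-4 * a ^ 2 * b ^ 2) * hδ + (r * a ^ 2 - s * b ^ 2 + 1) * h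
  refine Associated.symm ⟨Units.mkOfMulEqOne _ _ hunit, ?_⟩
  rw [Units.val_mkOfMulEqOne]
  linear_combination (- b ^ 2) * hδ

variable (K : Type*) [Field K] [NumberField K]

/-- The ideal class of the product of the prime ideals above `p`; for `p` ramified in a biquadratic
field, these classes generate the Pólya group. -/
noncomputable def primesOverClass (p : ℕ) : ClassGroup (𝓞 K) :=
  ClassGroup.mk0 ⟨prodPrimesOver K p,
    mem_nonZeroDivisors_iff_ne_zero.mpr (squarefree_prodPrimesOver K p).ne_zero⟩

/-- `g` is the class of an ideal whose square is generated by `n`, a stand-in for the ideal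
generated by a possibly missing square root of `n`. -/
def IsClassOfSqrt (n : ℕ) (g : ClassGroup (𝓞 K)) : Prop :=
  ∃ J : (Ideal (𝓞 K))⁰, (J : Ideal (𝓞 K)) ^ 2 = Ideal.span {(n : 𝓞 K)} ∧ ClassGroup.mk0 J = g

variable {K}

theorem mk0_eq_primesOverClass {p : ℕ} {I : (Ideal (𝓞 K))⁰}
    (hI : (I : Ideal (𝓞 K)) = prodPrimesOver K p) : ClassGroup.mk0 I = primesOverClass K p :=
  congrArg ClassGroup.mk0 (Subtype.ext hI)

namespace IsClassOfSqrt

theorem prod {ι : Type*} {s : Finset ι} {n : ι → ℕ} {g : ι → ClassGroup (𝓞 K)}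
    (h : ∀ i ∈ s, IsClassOfSqrt K (n i) (g i)) : IsClassOfSqrt K (∏ i ∈ s, n i) (∏ i ∈ s, g i) := by
  choose! J hJ hg using h
  refine ⟨∏ i ∈ s, J i, ?_, by rw [map_prod, Finset.prod_congr rfl hg]⟩
  rw [Submonoid.coe_finsetProd, ← Finset.prod_pow, Finset.prod_congr rfl hJ,
    Ideal.prod_span_singleton, Nat.cast_prod]

theorem eq_one {n : ℕ} {g : ClassGroup (𝓞 K)} (hg : IsClassOfSqrt K n g) {c : 𝓞 K}
    (hc : Associated (c ^ 2) (n : 𝓞 K)) : g = 1 := by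
  obtain ⟨J, hJ, rfl⟩ := hg
  exact (ClassGroup.mk0_eq_one_iff _).mpr (isPrincipal_of_sq_eq_span hc hJ)

theorem sq_eq_one {n : ℕ} {g : ClassGroup (𝓞 K)} (hg : IsClassOfSqrt K n g) : g ^ 2 = 1 := by
  obtain ⟨J, hJ, rfl⟩ := hg
  rw [← map_pow, ClassGroup.mk0_eq_one_iff, SubmonoidClass.coe_pow, hJ]
  exact ⟨_, rfl⟩

end IsClassOfSqrt

variable {S T : Finset ℕ} {g : ℕ → ClassGroup (𝓞 K)} {δ : K}

theorem prod_eq_one_of_isClassOfSqrt (hg : ∀ p ∈ S, IsClassOfSqrt K p (g p))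
    (hδ : δ ^ 2 = ((∏ p ∈ S, p : ℕ) : K)) : ∏ p ∈ S, g p = 1 := by
  obtain ⟨c, hc⟩ := exists_integer_sq_eq_natCast hδ
  exact (IsClassOfSqrt.prod hg).eq_one (.of_eq hc)

theorem IsPellSplitting.prod_eq_one (hT : IsPellSplitting S T)
    (hg : ∀ p ∈ S, IsClassOfSqrt K p (g p)) (hδ : δ ^ 2 = ((∏ p ∈ S, p : ℕ) : K)) :
    ∏ p ∈ S, (if p ∈ T then g p else 1) = 1 := by
  rw [Finset.prod_ite_mem, Finset.inter_eq_right.mpr hT.subset]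
  obtain ⟨c, hc⟩ := exists_integer_sq_eq_natCast hδ
  obtain ⟨a, b, hab⟩ := hT.exists_mul_sq_eq
  rw [← Finset.prod_sdiff hT.subset, mul_comm, Nat.cast_mul] at hc
  have hab' := congrArg (Nat.cast : ℕ → 𝓞 K) hab
  rw [Nat.cast_mul, Nat.cast_add, Nat.cast_mul, Nat.cast_pow, Nat.cast_pow, Nat.cast_one] at hab'
  exact (IsClassOfSqrt.prod fun p hp => hg p (hT.subset hp)).eq_one
    (associated_sq_of_mul_sq_eq hc hab')

theorem eq_one_of_isClassOfSqrt_of_mod_four_eq_three {p q : ℕ} (hp : p.Prime) (hq : q.Prime)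
    (hpq : p ≠ q) (hp4 : p % 4 = 3) (hq4 : q % 4 = 3) (hgp : IsClassOfSqrt K p (g p))
    (hgq : IsClassOfSqrt K q (g q)) (hδ : δ ^ 2 = ((p * q : ℕ) : K)) : g p = 1 ∧ g q = 1 := by
  have : Fact p.Prime := ⟨hp⟩
  have hg : ∀ r ∈ ({p, q} : Finset ℕ), IsClassOfSqrt K r (g r) := by simp [hgp, hgq]
  have hmod : (∏ r ∈ {p, q}, r) % 4 = 1 := by
    rw [Finset.prod_pair hpq, Nat.mul_mod, hp4, hq4]
  rw [← Finset.prod_pair (f := fun r => r) hpq] at hδ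
  obtain ⟨T, ⟨r, hr⟩, hT⟩ := exists_isPellSplitting (by simp [hp, hq]) ⟨p, by simp⟩ hmod
  obtain ⟨s, hs, hsT⟩ := hT.exists_notMem_of_mod_four_eq_three (p := p) (by simp) hp4
  have hS := prod_eq_one_of_isClassOfSqrt hg hδ
  have hT' := hT.prod_eq_one hg hδ
  have hrS := hT.subset hr
  simp only [Finset.mem_insert, Finset.mem_singleton, Finset.prod_pair hpq] at hS hT' hrS hs
  grind

/- A splitting isolates one of the three primes, and the class of that prime is then trivial. -/
theorem eq_one_of_isClassOfSqrt_triple {p₁ p₂ p₃ : ℕ} (hp₁ : p₁.Prime) (hp₂ : p₂.Prime)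
    [Fact p₃.Prime] (h : [p₁, p₂, p₃].Nodup) (hp₁4 : p₁ % 4 = 3) (hp₃4 : p₃ % 4 = 1)
    (hmod : p₁ * p₂ * p₃ % 4 = 1) (hg₁ : IsClassOfSqrt K p₁ (g p₁))
    (hg₂ : IsClassOfSqrt K p₂ (g p₂)) (hg₃ : IsClassOfSqrt K p₃ (g p₃))
    (hδ : δ ^ 2 = ((p₁ * p₂ * p₃ : ℕ) : K)) :
    g p₁ * g p₂ * g p₃ = 1 ∧
      (g p₁ = 1 ∧ legendreSym p₃ p₁ = 1 ∨ g p₂ = 1 ∧ legendreSym p₃ p₂ = 1 ∨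
        g p₃ = 1 ∧ legendreSym p₃ p₁ * legendreSym p₃ p₂ = 1) := by
  have : Fact p₁.Prime := ⟨hp₁⟩
  have h₂₃ : p₂ ≠ p₃ := by grind
  have h₁ : p₁ ∉ ({p₂, p₃} : Finset ℕ) := by grind
  have hg : ∀ r ∈ ({p₁, p₂, p₃} : Finset ℕ), IsClassOfSqrt K r (g r) := by simp [hg₁, hg₂, hg₃]
  have hS : ∏ r ∈ {p₁, p₂, p₃}, r = p₁ * p₂ * p₃ := by
    rw [Finset.prod_insert h₁, Finset.prod_pair h₂₃, mul_assoc]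
  rw [← hS] at hmod hδ
  obtain ⟨T, ⟨r, hr⟩, hT⟩ := exists_isPellSplitting
    (by simp [hp₁, hp₂, (Fact.out : p₃.Prime)]) ⟨p₁, by simp⟩ hmod
  obtain ⟨s, hs, hsT⟩ := hT.exists_notMem_of_mod_four_eq_three (p := p₁) (by simp) hp₁4
  have hrS := hT.subset hr
  have hgS := prod_eq_one_of_isClassOfSqrt hg hδ
  have hgT := hT.prod_eq_one hg hδ
  have hleg := hT.prod_legendreSym_eq_of_mod_four_eq_one (p := p₃) (by simp) hp₃4
  simp only [Finset.mem_insert, Finset.mem_singleton, Finset.prod_insert h₁, Finset.prod_pair h₂₃]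
    at hgS hgT hrS hs hleg
  refine ⟨by rw [mul_assoc, hgS], ?_⟩
  grind

end Classes

theorem eq_bot_or_nonempty_mulEquiv_of_le_zpowers {G : Type*} [Group G] {g : G} (hg : g ^ 2 = 1)
    {H : Subgroup G} (hH : H ≤ Subgroup.zpowers g) :
    H = ⊥ ∨ Nonempty (H ≃* Multiplicative (ZMod 2)) := by
  have hdvd : Nat.card H ∣ 2 :=
    (Subgroup.card_dvd_of_le hH).trans (Nat.card_zpowers g ▸ orderOf_dvd_of_pow_eq_one hg)
  rcases (Nat.dvd_prime Nat.prime_two).mp hdvd with h | h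
  · exact .inl (Subgroup.card_eq_one.mp h)
  · exact .inr ⟨mulEquivOfPrimeCardEq (p := 2) h (by simp)⟩

namespace IsBiquadratic

variable {K : Type*} [Field K] [NumberField K] {d₁ d₂ p : ℕ} {α β : K}

theorem isClassOfSqrt_of_mem (h : IsBiquadratic d₁ d₂ α β) {S : Finset ℕ} (hS : ∀ p ∈ S, p.Prime)
    (hprod : ∏ p ∈ S, p = d₁ * d₂) (hp : p ∈ S) : IsClassOfSqrt K p (primesOverClass K p) := by
  have : Fact p.Prime := ⟨hS p hp⟩
  exact ⟨⟨prodPrimesOver K p, mem_nonZeroDivisors_iff_ne_zero.mpr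
    (squarefree_prodPrimesOver K p).ne_zero⟩,
    h.prodPrimesOver_sq_of_dvd (hprod ▸ Finset.dvd_prod_of_mem (fun p => p) hp), rfl⟩

theorem polyaGroup_le (h : IsBiquadratic d₁ d₂ α β) {S : Finset ℕ} (hS : ∀ p ∈ S, p.Prime)
    (hprod : ∏ p ∈ S, p = d₁ * d₂) {H : Subgroup (ClassGroup (𝓞 K))}
    (hH : ∀ p ∈ S, primesOverClass K p ∈ H) : polyaGroup K ≤ H := by
  have := h.isGalois
  rw [polyaGroup, Subgroup.closure_le]
  rintro c ⟨p, f, hp, -, rfl⟩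
  have : Fact p.Prime := ⟨hp⟩
  have hmem (hI : (ostrowskiIdeal K (p ^ f)).IsPrincipal) : ClassGroup.mk0
      ⟨ostrowskiIdeal K (p ^ f), ostrowskiIdeal_mem_nonZeroDivisors K (p ^ f)⟩ ∈ H := by
    rw [(ClassGroup.mk0_eq_one_iff _).mpr hI]
    exact H.one_mem
  rcases ostrowskiIdeal_eq_one_or_eq_prodPrimesOver K p f with hI | hI
  · exact hmem (by rw [hI, Ideal.one_eq_top]; exact top_isPrincipal)
  by_cases hpd : p ∣ d₁ * d₂
  · rw [SetLike.mem_coe, mk0_eq_primesOverClass hI]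
    rw [← hprod, hp.prime.dvd_finsetProd_iff] at hpd
    obtain ⟨q, hq, hpq⟩ := hpd
    obtain rfl := (Nat.prime_dvd_prime_iff_eq hp (hS q hq)).mp hpq
    exact hH p hq
  · exact hmem (by rw [hI, ← h.span_eq_prodPrimesOver_of_not_dvd hpd]; exact ⟨_, rfl⟩)

/- A splitting that separates `i` from `j` kills the class they share. -/
theorem isPolyaField_of_forall_isPellSplitting (h : IsBiquadratic d₁ d₂ α β) {S : Finset ℕ}
    (hS : ∀ p ∈ S, p.Prime) (hprod : ∏ p ∈ S, p = d₁ * d₂) {i j : ℕ} (hi : i ∈ S) (hj : j ∈ S)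
    (hij : primesOverClass K i * primesOverClass K j = 1)
    (hne : ∀ p ∈ S, p ≠ i → p ≠ j → primesOverClass K p = 1)
    (hT : ∀ T, IsPellSplitting S T → (i ∈ T ↔ j ∈ T) → T = ∅) : IsPolyaField K := by
  have hmod : (∏ p ∈ S, p) % 4 = 1 := by
    rw [hprod, Nat.mul_mod, h.mod_four_left, h.mod_four_right]
  obtain ⟨T, hTne, hpell⟩ := exists_isPellSplitting hS ⟨i, hi⟩ hmod
  have hprod_eq_one := hpell.prod_eq_one (fun p => h.isClassOfSqrt_of_mem hS hprod)
    (δ := α * β) (by rw [hprod, mul_pow, h.sq_left, h.sq_right, Nat.cast_mul])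
  have hi_eq_one : primesOverClass K i = 1 := by
    wlog hiT : i ∈ T generalizing i j
    · have hj_eq_one := this hj hi ((mul_comm _ _).trans hij) (fun p hp hpj hpi => hne p hp hpi hpj)
        (fun T hpell hiff => hT T hpell hiff.symm) (by grind)
      rwa [hj_eq_one, mul_one] at hij
    rwa [Finset.prod_eq_single_of_mem i hi, if_pos hiT] at hprod_eq_one
    grind
  refine (isPolyaField_iff K).mpr (le_bot_iff.mp (h.polyaGroup_le hS hprod fun p hp => ?_))
  rw [hi_eq_one, one_mul] at hij
  rw [Subgroup.mem_bot]
  by_cases hpi : p = i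
  · exact hpi ▸ hi_eq_one
  by_cases hpj : p = j
  · exact hpj ▸ hij
  · exact hne p hp hpi hpj

end IsBiquadratic

/-- The arithmetic shape of the primes in `K = ℚ(√(q₁ * q₂), √(p₁ * p₂ * p₃))`: they are distinct,
`p₃` is `1` modulo `4` and the other four are `3` modulo `4`. -/
structure IsAdmissible (p₁ p₂ p₃ q₁ q₂ : ℕ) : Prop where
  nodup : [p₁, p₂, p₃, q₁, q₂].Nodup
  mod_four_p₁ : p₁ % 4 = 3
  mod_four_p₂ : p₂ % 4 = 3
  mod_four_p₃ : p₃ % 4 = 1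
  mod_four_q₁ : q₁ % 4 = 3
  mod_four_q₂ : q₂ % 4 = 3

namespace IsAdmissible

variable {p₁ p₂ p₃ q₁ q₂ : ℕ}

theorem swap_left (h : IsAdmissible p₁ p₂ p₃ q₁ q₂) : IsAdmissible p₂ p₁ p₃ q₁ q₂ where
  nodup := (List.Perm.swap p₂ p₁ [p₃, q₁, q₂]).nodup h.nodup
  mod_four_p₁ := h.mod_four_p₂
  mod_four_p₂ := h.mod_four_p₁
  mod_four_p₃ := h.mod_four_p₃
  mod_four_q₁ := h.mod_four_q₁
  mod_four_q₂ := h.mod_four_q₂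

theorem swap_right (h : IsAdmissible p₁ p₂ p₃ q₁ q₂) : IsAdmissible p₁ p₂ p₃ q₂ q₁ where
  nodup := ((((List.Perm.swap q₂ q₁ []).cons p₃).cons p₂).cons p₁).nodup h.nodup
  mod_four_p₁ := h.mod_four_p₁
  mod_four_p₂ := h.mod_four_p₂
  mod_four_p₃ := h.mod_four_p₃
  mod_four_q₁ := h.mod_four_q₂
  mod_four_q₂ := h.mod_four_q₁

theorem prod_eq {M : Type*} [CommMonoid M] (h : IsAdmissible p₁ p₂ p₃ q₁ q₂) (f : ℕ → M) :
    ∏ p ∈ {p₁, p₂, p₃, q₁, q₂}, f p = f q₁ * f q₂ * (f p₁ * f p₂ * f p₃) := by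
  have hnodup := h.nodup
  rw [Finset.prod_insert (by grind), Finset.prod_insert (by grind), Finset.prod_insert (by grind),
    Finset.prod_pair (by grind)]
  ac_rfl

theorem p₁_ne_p₂ (h : IsAdmissible p₁ p₂ p₃ q₁ q₂) : p₁ ≠ p₂ := by
  have := h.nodup
  grind

theorem p₁_ne_two (h : IsAdmissible p₁ p₂ p₃ q₁ q₂) : p₁ ≠ 2 := by
  have := h.mod_four_p₁
  rintro rfl
  omega

theorem q₁_ne_two (h : IsAdmissible p₁ p₂ p₃ q₁ q₂) : q₁ ≠ 2 := by
  have := h.mod_four_q₁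
  rintro rfl
  omega

variable [Fact p₁.Prime] [Fact p₂.Prime] [Fact p₃.Prime] [Fact q₁.Prime] [Fact q₂.Prime]

theorem prime_of_mem {p : ℕ} (hp : p ∈ ({p₁, p₂, p₃, q₁, q₂} : Finset ℕ)) : p.Prime := by
  simp only [Finset.mem_insert, Finset.mem_singleton] at hp
  rcases hp with rfl | rfl | rfl | rfl | rfl <;> exact Fact.out

theorem isBiquadratic (h : IsAdmissible p₁ p₂ p₃ q₁ q₂) {K : Type*} [Field K] [NumberField K]
    {α β : K} (hα : α ^ 2 = ((q₁ * q₂ : ℕ) : K)) (hβ : β ^ 2 = ((p₁ * p₂ * p₃ : ℕ) : K))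
    (hK : IntermediateField.adjoin ℚ {α, β} = ⊤) :
    IsBiquadratic (q₁ * q₂) (p₁ * p₂ * p₃) α β where
  sq_left := hα
  sq_right := hβ
  adjoin_eq_top := hK
  mod_four_left := by simp [Nat.mul_mod, h.mod_four_q₁, h.mod_four_q₂]
  mod_four_right := by simp [Nat.mul_mod, h.mod_four_p₁, h.mod_four_p₂, h.mod_four_p₃]
  squarefree_mul := by
    rw [← h.prod_eq fun p => p]
    exact Finset.squarefree_prod_of_pairwise_isCoprime
      (fun p hp q hq hpq => Nat.coprime_iff_isRelPrime.mp
        ((Nat.coprime_primes (prime_of_mem hp) (prime_of_mem hq)).mpr hpq))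
      fun p hp => (prime_of_mem hp).squarefree

end IsAdmissible

section Splittings

theorem legendreSym_mul_eq_of_three_mod_four {p q r : ℕ} [Fact p.Prime] [Fact q.Prime]
    [Fact r.Prime] (hp : p % 4 = 3) (hq : q % 4 = 3) (hr : r % 4 = 3) :
    legendreSym p (q * r) = legendreSym q p * legendreSym r p := by
  rw [legendreSym.mul, legendreSym.quadratic_reciprocity_three_mod_four hq hp,
    legendreSym.quadratic_reciprocity_three_mod_four hr hp, neg_mul_neg]

variable {p₁ p₂ p₃ q₁ q₂ : ℕ} {T : Finset ℕ}

theorem IsPellSplitting.eq_empty (hT : IsPellSplitting {p₁, p₂, p₃, q₁, q₂} T) (hp₁ : p₁ ∉ T)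
    (hp₂ : p₂ ∉ T) (hp₃ : p₃ ∉ T) (hq₁ : q₁ ∉ T) (hq₂ : q₂ ∉ T) : T = ∅ := by
  refine Finset.eq_empty_of_forall_notMem fun p hp => ?_
  have := hT.subset hp
  simp only [Finset.mem_insert, Finset.mem_singleton] at this
  rcases this with rfl | rfl | rfl | rfl | rfl <;> contradiction

namespace IsAdmissible

theorem mem_q₁_iff_mem_q₂ [Fact p₃.Prime] [Fact q₁.Prime] [Fact q₂.Prime]
    (h : IsAdmissible p₁ p₂ p₃ q₁ q₂) (hT : IsPellSplitting {p₁, p₂, p₃, q₁, q₂} T)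
    (h₂₃ : p₂ ∈ T ↔ p₃ ∈ T) (hp₁p₃ : legendreSym p₃ p₁ = 1) (hp₃q₁ : legendreSym q₁ p₃ = -1)
    (hp₃q₂ : legendreSym q₂ p₃ = -1) : q₁ ∈ T ↔ q₂ ∈ T := by
  have hrel := hT.prod_legendreSym_eq_of_mod_four_eq_one (p := p₃) (by simp) h.mod_four_p₃
  rw [h.prod_eq, hp₁p₃,
    ← legendreSym.quadratic_reciprocity_one_mod_four h.mod_four_p₃ h.q₁_ne_two, hp₃q₁,
    ← legendreSym.quadratic_reciprocity_one_mod_four h.mod_four_p₃ h.swap_right.q₁_ne_two, hp₃q₂]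
    at hrel
  simp only [iff_self, h₂₃, if_true, ite_self, mul_one] at hrel
  grind

theorem mul_eq_of_q₁ [Fact q₁.Prime] (h : IsAdmissible p₁ p₂ p₃ q₁ q₂)
    (hT : IsPellSplitting {p₁, p₂, p₃, q₁, q₂} T) (h₂₃ : p₂ ∈ T ↔ p₃ ∈ T) (hq : q₁ ∈ T ↔ q₂ ∈ T)
    (hp₃q₁ : legendreSym q₁ p₃ = -1) :
    (if p₁ ∈ T ↔ q₁ ∈ T then 1 else legendreSym q₁ p₁) *
      (if p₂ ∈ T ↔ q₁ ∈ T then 1 else -legendreSym q₁ p₂) = if q₁ ∈ T then -1 else 1 := by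
  rw [← hT.prod_legendreSym_eq_of_mod_four_eq_three (p := q₁) (by simp) h.mod_four_q₁, h.prod_eq,
    hp₃q₁]
  simp only [iff_self, ← hq, ← h₂₃, if_true, one_mul]
  split_ifs <;> ring

theorem mul_eq_of_p₂ [Fact p₂.Prime] (h : IsAdmissible p₁ p₂ p₃ q₁ q₂)
    (hT : IsPellSplitting {p₁, p₂, p₃, q₁, q₂} T) (h₂₃ : p₂ ∈ T ↔ p₃ ∈ T)
    (hq : q₁ ∈ T ↔ q₂ ∈ T) :
    (if p₁ ∈ T ↔ p₂ ∈ T then 1 else legendreSym p₂ p₁) *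
      (if q₁ ∈ T ↔ p₂ ∈ T then 1 else legendreSym p₂ (q₁ * q₂)) = if p₂ ∈ T then -1 else 1 := by
  rw [← hT.prod_legendreSym_eq_of_mod_four_eq_three (p := p₂) (by simp) h.mod_four_p₂, h.prod_eq,
    legendreSym.mul]
  simp only [iff_self, ← hq, ← h₂₃, if_true]
  split_ifs <;> ring

theorem mem_q₂_iff_mem_p₃ [Fact p₃.Prime] [Fact q₁.Prime] [Fact q₂.Prime]
    (h : IsAdmissible p₁ p₂ p₃ q₁ q₂) (hT : IsPellSplitting {p₁, p₂, p₃, q₁, q₂} T)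
    (h₁₂ : p₁ ∈ T ↔ p₂ ∈ T) (hp₁p₃ : legendreSym p₃ p₁ = -1) (hp₂p₃ : legendreSym p₃ p₂ = -1)
    (hp₃q₁ : legendreSym q₁ p₃ = 1) (hp₃q₂ : legendreSym q₂ p₃ = -1) : q₂ ∈ T ↔ p₃ ∈ T := by
  have hrel := hT.prod_legendreSym_eq_of_mod_four_eq_one (p := p₃) (by simp) h.mod_four_p₃
  rw [h.prod_eq, hp₁p₃, hp₂p₃,
    ← legendreSym.quadratic_reciprocity_one_mod_four h.mod_four_p₃ h.q₁_ne_two, hp₃q₁,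
    ← legendreSym.quadratic_reciprocity_one_mod_four h.mod_four_p₃ h.swap_right.q₁_ne_two, hp₃q₂]
    at hrel
  simp only [iff_self, h₁₂, if_true, ite_self, mul_one, one_mul] at hrel
  grind

theorem mul_eq_of_p₁ [Fact p₁.Prime] [Fact p₃.Prime] [Fact q₁.Prime] [Fact q₂.Prime]
    (h : IsAdmissible p₁ p₂ p₃ q₁ q₂)
    (hT : IsPellSplitting {p₁, p₂, p₃, q₁, q₂} T) (h₁₂ : p₁ ∈ T ↔ p₂ ∈ T)
    (hp₁p₃ : legendreSym p₃ p₁ = -1) (hq₂ : q₂ ∈ T ↔ p₃ ∈ T) :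
    (if q₁ ∈ T ↔ p₁ ∈ T then 1 else -legendreSym q₁ p₁) *
      (if q₂ ∈ T ↔ p₁ ∈ T then 1 else legendreSym q₂ p₁) = if p₁ ∈ T then -1 else 1 := by
  rw [← hT.prod_legendreSym_eq_of_mod_four_eq_three (p := p₁) (by simp) h.mod_four_p₁, h.prod_eq,
    ← legendreSym.quadratic_reciprocity_three_mod_four h.mod_four_q₁ h.mod_four_p₁,
    legendreSym.quadratic_reciprocity_one_mod_four h.mod_four_p₃ h.p₁_ne_two, hp₁p₃,
    legendreSym.quadratic_reciprocity_three_mod_four h.mod_four_q₂ h.mod_four_p₁]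
  simp only [iff_self, ← h₁₂, ← hq₂, if_true]
  split_ifs <;> ring

variable [Fact p₂.Prime] [Fact p₃.Prime] [Fact q₁.Prime] [Fact q₂.Prime]

theorem eq_empty_of_legendreSym_p₂_mul_eq_neg_one (h : IsAdmissible p₁ p₂ p₃ q₁ q₂)
    (hT : IsPellSplitting {p₁, p₂, p₃, q₁, q₂} T) (h₂₃ : p₂ ∈ T ↔ p₃ ∈ T)
    (hp₁p₃ : legendreSym p₃ p₁ = 1) (hp₃q₁ : legendreSym q₁ p₃ = -1)
    (hp₃q₂ : legendreSym q₂ p₃ = -1) (hp₁p₂ : legendreSym p₂ p₁ = 1)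
    (hp₁q₁ : legendreSym q₁ p₁ = -1) (hp₁q₂ : legendreSym q₂ p₁ = -1)
    (hp₂ : legendreSym p₂ (q₁ * q₂) = -1) : T = ∅ := by
  have hq := h.mem_q₁_iff_mem_q₂ hT h₂₃ hp₁p₃ hp₃q₁ hp₃q₂
  have hrelp := h.mul_eq_of_p₂ hT h₂₃ hq
  have hrelq₁ := h.mul_eq_of_q₁ hT h₂₃ hq hp₃q₁
  have hrelq₂ := h.swap_right.mul_eq_of_q₁ (Finset.pair_comm q₁ q₂ ▸ hT) h₂₃ hq.symm hp₃q₂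
  rw [legendreSym_mul_eq_of_three_mod_four h.mod_four_p₂ h.mod_four_q₁ h.mod_four_q₂] at hp₂ hrelp
  have : p₁ ∉ T ∧ p₂ ∉ T ∧ q₁ ∉ T := by grind
  exact hT.eq_empty this.1 this.2.1 (by grind) this.2.2 (by grind)

variable [Fact p₁.Prime]

theorem eq_empty_of_legendreSym_p₁_mul_eq_neg_one (h : IsAdmissible p₁ p₂ p₃ q₁ q₂)
    (hT : IsPellSplitting {p₁, p₂, p₃, q₁, q₂} T) (h₂₃ : p₂ ∈ T ↔ p₃ ∈ T)
    (hp₁p₃ : legendreSym p₃ p₁ = 1) (hp₃q₁ : legendreSym q₁ p₃ = -1)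
    (hp₃q₂ : legendreSym q₂ p₃ = -1) (hp₂q₁ : legendreSym q₁ p₂ = legendreSym p₁ p₂)
    (hp₂q₂ : legendreSym q₂ p₂ = legendreSym p₁ p₂)
    (hp₁ : legendreSym p₁ (q₁ * q₂) = -1) : T = ∅ := by
  have hq := h.mem_q₁_iff_mem_q₂ hT h₂₃ hp₁p₃ hp₃q₁ hp₃q₂
  have hrelp := h.mul_eq_of_p₂ hT h₂₃ hq
  have hrelq₁ := h.mul_eq_of_q₁ hT h₂₃ hq hp₃q₁
  have hrelq₂ := h.swap_right.mul_eq_of_q₁ (Finset.pair_comm q₁ q₂ ▸ hT) h₂₃ hq.symm hp₃q₂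
  have hp₁p₂ := legendreSym.quadratic_reciprocity_three_mod_four h.mod_four_p₁ h.mod_four_p₂
  rw [legendreSym_mul_eq_of_three_mod_four h.mod_four_p₂ h.mod_four_q₁ h.mod_four_q₂] at hrelp
  rw [legendreSym_mul_eq_of_three_mod_four h.mod_four_p₁ h.mod_four_q₁ h.mod_four_q₂] at hp₁
  have hsign := legendreSym.eq_one_or_neg_one p₁ (a := p₂)
    (by simpa using ZMod.prime_ne_zero p₁ p₂ h.p₁_ne_p₂)
  have : p₁ ∉ T ∧ p₂ ∉ T ∧ q₁ ∉ T := by grind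
  exact hT.eq_empty this.1 this.2.1 (by grind) this.2.2 (by grind)

theorem eq_empty_of_legendreSym_mul_eq_one (h : IsAdmissible p₁ p₂ p₃ q₁ q₂)
    (hT : IsPellSplitting {p₁, p₂, p₃, q₁, q₂} T) (h₂₃ : p₂ ∈ T ↔ p₃ ∈ T)
    (hp₁p₃ : legendreSym p₃ p₁ = 1) (hp₃q₁ : legendreSym q₁ p₃ = -1)
    (hp₃q₂ : legendreSym q₂ p₃ = -1) (hq₁ : legendreSym q₁ (p₁ * p₂) = 1)
    (hq₂ : legendreSym q₂ (p₁ * p₂) = 1) (hp₁ : legendreSym p₁ (q₁ * q₂) = -1) : T = ∅ := by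
  have hq := h.mem_q₁_iff_mem_q₂ hT h₂₃ hp₁p₃ hp₃q₁ hp₃q₂
  have hrelp := h.mul_eq_of_p₂ hT h₂₃ hq
  have hrelq₁ := h.mul_eq_of_q₁ hT h₂₃ hq hp₃q₁
  have hrelq₂ := h.swap_right.mul_eq_of_q₁ (Finset.pair_comm q₁ q₂ ▸ hT) h₂₃ hq.symm hp₃q₂
  rw [legendreSym_mul_eq_of_three_mod_four h.mod_four_p₂ h.mod_four_q₁ h.mod_four_q₂] at hrelp
  rw [legendreSym_mul_eq_of_three_mod_four h.mod_four_p₁ h.mod_four_q₁ h.mod_four_q₂] at hp₁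
  rw [legendreSym.mul] at hq₁ hq₂
  have : p₁ ∉ T ∧ p₂ ∉ T ∧ q₁ ∉ T := by grind
  exact hT.eq_empty this.1 this.2.1 (by grind) this.2.2 (by grind)

theorem eq_empty_of_legendreSym_mul_eq_neg_one (h : IsAdmissible p₁ p₂ p₃ q₁ q₂)
    (hT : IsPellSplitting {p₁, p₂, p₃, q₁, q₂} T) (h₁₂ : p₁ ∈ T ↔ p₂ ∈ T)
    (hp₁p₃ : legendreSym p₃ p₁ = -1) (hp₂p₃ : legendreSym p₃ p₂ = -1)
    (hp₃q₁ : legendreSym q₁ p₃ = 1) (hp₃q₂ : legendreSym q₂ p₃ = -1)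
    (hq₁ : legendreSym q₁ (p₁ * p₂) = -1) (hq₂ : legendreSym q₂ (p₁ * p₂) = -1)
    (hp₁ : legendreSym p₁ (q₁ * q₂) = 1) : T = ∅ := by
  have hq := h.mem_q₂_iff_mem_p₃ hT h₁₂ hp₁p₃ hp₂p₃ hp₃q₁ hp₃q₂
  have hrelp₁ := h.mul_eq_of_p₁ hT h₁₂ hp₁p₃ hq
  have hrelp₂ := h.swap_left.mul_eq_of_p₁ (Finset.insert_comm p₁ p₂ _ ▸ hT) h₁₂.symm hp₂p₃ hq
  have hrelq := hT.prod_legendreSym_eq_of_mod_four_eq_three (p := q₁) (by simp) h.mod_four_q₁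
  rw [h.prod_eq, hp₃q₁] at hrelq
  rw [legendreSym_mul_eq_of_three_mod_four h.mod_four_p₁ h.mod_four_q₁ h.mod_four_q₂] at hp₁
  rw [legendreSym.mul] at hq₁ hq₂
  simp only [iff_self, if_true, ite_self, mul_one, one_mul] at hrelq
  have hqT : q₁ ∈ T ↔ q₂ ∈ T := by grind
  have : p₁ ∉ T ∧ q₁ ∉ T := by grind
  exact hT.eq_empty this.1 (by grind) (by grind) this.2 (by grind)

end IsAdmissible

end Splittings

namespace IsAdmissible

variable {p₁ p₂ p₃ q₁ q₂ : ℕ} [Fact p₁.Prime] [Fact p₂.Prime] [Fact p₃.Prime] [Fact q₁.Prime]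
  [Fact q₂.Prime] {K : Type*} [Field K] [NumberField K] {α β : K}

theorem isClassOfSqrt_of_mem (h : IsAdmissible p₁ p₂ p₃ q₁ q₂)
    (hK : IsBiquadratic (q₁ * q₂) (p₁ * p₂ * p₃) α β) {p : ℕ}
    (hp : p ∈ ({p₁, p₂, p₃, q₁, q₂} : Finset ℕ)) : IsClassOfSqrt K p (primesOverClass K p) :=
  hK.isClassOfSqrt_of_mem (fun _ => prime_of_mem) (h.prod_eq _) hp

theorem primesOverClass_eq_one (h : IsAdmissible p₁ p₂ p₃ q₁ q₂)
    (hK : IsBiquadratic (q₁ * q₂) (p₁ * p₂ * p₃) α β) :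
    primesOverClass K q₁ = 1 ∧ primesOverClass K q₂ = 1 := by
  have hnodup := h.nodup
  exact eq_one_of_isClassOfSqrt_of_mod_four_eq_three Fact.out Fact.out (by grind)
    h.mod_four_q₁ h.mod_four_q₂ (h.isClassOfSqrt_of_mem hK (by simp))
    (h.isClassOfSqrt_of_mem hK (by simp)) hK.sq_left

theorem primesOverClass_mul_eq_one (h : IsAdmissible p₁ p₂ p₃ q₁ q₂)
    (hK : IsBiquadratic (q₁ * q₂) (p₁ * p₂ * p₃) α β) :
    primesOverClass K p₁ * primesOverClass K p₂ * primesOverClass K p₃ = 1 ∧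
      (primesOverClass K p₁ = 1 ∧ legendreSym p₃ p₁ = 1 ∨
        primesOverClass K p₂ = 1 ∧ legendreSym p₃ p₂ = 1 ∨
        primesOverClass K p₃ = 1 ∧ legendreSym p₃ p₁ * legendreSym p₃ p₂ = 1) := by
  have hnodup := h.nodup
  exact eq_one_of_isClassOfSqrt_triple Fact.out Fact.out (by grind) h.mod_four_p₁ h.mod_four_p₃
    hK.mod_four_right (h.isClassOfSqrt_of_mem hK (by simp)) (h.isClassOfSqrt_of_mem hK (by simp))
    (h.isClassOfSqrt_of_mem hK (by simp)) hK.sq_right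

theorem isPolyaField_of_legendreSym_eq_one (h : IsAdmissible p₁ p₂ p₃ q₁ q₂)
    (hK : IsBiquadratic (q₁ * q₂) (p₁ * p₂ * p₃) α β) (hp₁ : legendreSym p₃ p₁ = 1)
    (hp₂ : legendreSym p₃ p₂ = -1)
    (hT : ∀ T, IsPellSplitting {p₁, p₂, p₃, q₁, q₂} T → (p₂ ∈ T ↔ p₃ ∈ T) → T = ∅) :
    IsPolyaField K := by
  obtain ⟨hq₁, hq₂⟩ := h.primesOverClass_eq_one hK
  obtain ⟨hprod, hone⟩ := h.primesOverClass_mul_eq_one hK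
  have hx₁ : primesOverClass K p₁ = 1 := by grind
  exact hK.isPolyaField_of_forall_isPellSplitting (fun _ => prime_of_mem) (h.prod_eq _)
    (by simp) (by simp) (by rwa [hx₁, one_mul] at hprod) (by grind) hT

theorem isPolyaField_of_legendreSym_eq_neg_one (h : IsAdmissible p₁ p₂ p₃ q₁ q₂)
    (hK : IsBiquadratic (q₁ * q₂) (p₁ * p₂ * p₃) α β) (hp₁ : legendreSym p₃ p₁ = -1)
    (hp₂ : legendreSym p₃ p₂ = -1)
    (hT : ∀ T, IsPellSplitting {p₁, p₂, p₃, q₁, q₂} T → (p₁ ∈ T ↔ p₂ ∈ T) → T = ∅) :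
    IsPolyaField K := by
  obtain ⟨hq₁, hq₂⟩ := h.primesOverClass_eq_one hK
  obtain ⟨hprod, hone⟩ := h.primesOverClass_mul_eq_one hK
  have hx₃ : primesOverClass K p₃ = 1 := by grind
  exact hK.isPolyaField_of_forall_isPellSplitting (fun _ => prime_of_mem) (h.prod_eq _)
    (by simp) (by simp) (by rwa [hx₃, mul_one] at hprod) (by grind) hT

theorem isPolyaField_or_nonempty_mulEquiv (h : IsAdmissible p₁ p₂ p₃ q₁ q₂)
    (hK : IsBiquadratic (q₁ * q₂) (p₁ * p₂ * p₃) α β) :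
    IsPolyaField K ∨ Nonempty (polyaGroup K ≃* Multiplicative (ZMod 2)) := by
  obtain ⟨hq₁, hq₂⟩ := h.primesOverClass_eq_one hK
  obtain ⟨hprod, hone⟩ := h.primesOverClass_mul_eq_one hK
  obtain ⟨i, hi, hzpowers⟩ : ∃ i ∈ ({p₁, p₂, p₃, q₁, q₂} : Finset ℕ),
      ∀ p ∈ ({p₁, p₂, p₃, q₁, q₂} : Finset ℕ),
        primesOverClass K p ∈ Subgroup.zpowers (primesOverClass K i) := by
    rcases hone with ⟨hx, -⟩ | ⟨hx, -⟩ | ⟨hx, -⟩ <;> rw [hx] at hprod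
    · rw [one_mul] at hprod
      exact ⟨p₂, by simp, by simp [hx, hq₁, hq₂, eq_inv_of_mul_eq_one_right hprod]⟩
    · rw [mul_one] at hprod
      exact ⟨p₁, by simp, by simp [hx, hq₁, hq₂, eq_inv_of_mul_eq_one_right hprod]⟩
    · rw [mul_one] at hprod
      exact ⟨p₁, by simp, by simp [hx, hq₁, hq₂, eq_inv_of_mul_eq_one_right hprod]⟩
  rw [isPolyaField_iff]
  exact eq_bot_or_nonempty_mulEquiv_of_le_zpowers (h.isClassOfSqrt_of_mem hK hi).sq_eq_one
    (hK.polyaGroup_le (fun _ => prime_of_mem) (h.prod_eq _) hzpowers)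

end IsAdmissible

theorem theorem1_general (p₁ p₂ p₃ q₁ q₂ : ℕ)
    [Fact p₁.Prime] [Fact p₂.Prime] [Fact p₃.Prime] [Fact q₁.Prime] [Fact q₂.Prime]
    (hdistinct : [p₁, p₂, p₃, q₁, q₂].Nodup)
    (hp₁ : p₁ ≡ 3 [MOD 4]) (hp₂ : p₂ ≡ 3 [MOD 4])
    (hq₁ : q₁ ≡ 3 [MOD 4]) (hq₂ : q₂ ≡ 3 [MOD 4]) (hp₃ : p₃ ≡ 1 [MOD 4])
    (K : Type*) [Field K] [NumberField K] (α β : K)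
    (hα : α ^ 2 = ((q₁ * q₂ : ℕ) : K)) (hβ : β ^ 2 = ((p₁ * p₂ * p₃ : ℕ) : K))
    (hK : IntermediateField.adjoin ℚ {α, β} = ⊤) :
    (legendreSym p₂ p₁ = 1 ∧ legendreSym p₃ p₁ = 1 ∧ legendreSym p₃ p₂ = -1 ∧
        legendreSym q₁ p₃ = -1 ∧ legendreSym q₂ p₃ = -1 ∧
        legendreSym q₁ p₁ = -1 ∧ legendreSym q₂ p₁ = -1 ∧
        legendreSym p₂ (q₁ * q₂) = -1 →
      IsPolyaField K) ∧
    (legendreSym p₃ p₁ = -1 ∧ legendreSym p₃ p₂ = 1 ∧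
        legendreSym q₁ p₃ = -1 ∧ legendreSym q₂ p₃ = -1 ∧
        legendreSym q₁ p₁ = legendreSym p₂ p₁ ∧ legendreSym q₂ p₁ = legendreSym p₂ p₁ ∧
        legendreSym p₂ (q₁ * q₂) = -1 →
      IsPolyaField K) ∧
    (legendreSym p₃ p₁ = -1 ∧ legendreSym p₃ p₂ = -1 ∧
        legendreSym q₁ p₃ = 1 ∧ legendreSym q₂ p₃ = -1 ∧
        legendreSym q₁ (p₁ * p₂) = -1 ∧ legendreSym q₂ (p₁ * p₂) = -1 ∧
        legendreSym p₁ (q₁ * q₂) = 1 →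
      IsPolyaField K) ∧
    (legendreSym p₃ p₁ = 1 ∧ legendreSym p₃ p₂ = -1 ∧
        legendreSym q₁ p₃ = -1 ∧ legendreSym q₂ p₃ = -1 ∧
        legendreSym q₁ (p₁ * p₂) = 1 ∧ legendreSym q₂ (p₁ * p₂) = 1 ∧
        legendreSym p₁ (q₁ * q₂) = -1 →
      IsPolyaField K) ∧
    (IsPolyaField K ∨ Nonempty (polyaGroup K ≃* Multiplicative (ZMod 2))) := by
  have h : IsAdmissible p₁ p₂ p₃ q₁ q₂ := ⟨hdistinct, hp₁, hp₂, hp₃, hq₁, hq₂⟩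
  have hbiq := h.isBiquadratic hα hβ hK
  have hbiq' : IsBiquadratic (q₁ * q₂) (p₂ * p₁ * p₃) α β := mul_comm p₁ p₂ ▸ hbiq
  refine ⟨?_, ?_, ?_, ?_, h.isPolyaField_or_nonempty_mulEquiv hbiq⟩
  · rintro ⟨hp₁p₂, hp₁p₃, hp₂p₃, hp₃q₁, hp₃q₂, hp₁q₁, hp₁q₂, hqp₂⟩
    exact h.isPolyaField_of_legendreSym_eq_one hbiq hp₁p₃ hp₂p₃ fun T hT h₂₃ =>
      h.eq_empty_of_legendreSym_p₂_mul_eq_neg_one hT h₂₃ hp₁p₃ hp₃q₁ hp₃q₂ hp₁p₂ hp₁q₁ hp₁q₂ hqp₂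
  · rintro ⟨hp₁p₃, hp₂p₃, hp₃q₁, hp₃q₂, hp₁q₁, hp₁q₂, hqp₂⟩
    exact h.swap_left.isPolyaField_of_legendreSym_eq_one hbiq' hp₂p₃ hp₁p₃ fun T hT h₁₃ =>
      h.swap_left.eq_empty_of_legendreSym_p₁_mul_eq_neg_one hT h₁₃ hp₂p₃ hp₃q₁ hp₃q₂ hp₁q₁ hp₁q₂
        hqp₂
  · rintro ⟨hp₁p₃, hp₂p₃, hp₃q₁, hp₃q₂, hq₁p, hq₂p, hqp₁⟩
    exact h.isPolyaField_of_legendreSym_eq_neg_one hbiq hp₁p₃ hp₂p₃ fun T hT h₁₂ =>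
      h.eq_empty_of_legendreSym_mul_eq_neg_one hT h₁₂ hp₁p₃ hp₂p₃ hp₃q₁ hp₃q₂ hq₁p hq₂p hqp₁
  · rintro ⟨hp₁p₃, hp₂p₃, hp₃q₁, hp₃q₂, hq₁p, hq₂p, hqp₁⟩
    exact h.isPolyaField_of_legendreSym_eq_one hbiq hp₁p₃ hp₂p₃ fun T hT h₂₃ =>
      h.eq_empty_of_legendreSym_mul_eq_one hT h₂₃ hp₁p₃ hp₃q₁ hp₃q₂ hq₁p hq₂p hqp₁

theorem theorem1 (p₁ p₂ p₃ q₁ q₂ : ℕ)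
    [Fact p₁.Prime] [Fact p₂.Prime] [Fact p₃.Prime] [Fact q₁.Prime] [Fact q₂.Prime]
    (hdistinct : [p₁, p₂, p₃, q₁, q₂].Nodup)
    (hp₁ : p₁ ≡ 3 [MOD 4]) (hp₂ : p₂ ≡ 3 [MOD 4])
    (hq₁ : q₁ ≡ 3 [MOD 4]) (hq₂ : q₂ ≡ 3 [MOD 4]) (hp₃ : p₃ ≡ 1 [MOD 4])
    (hq : q₁ * q₂ ≡ 1 [MOD 8]) (hp : p₁ * p₂ * p₃ ≡ 1 [MOD 8])
    -- `K = ℚ(α, β)` with `α = √(q₁q₂)` and `β = √(p₁p₂p₃)`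
    (K : Type*) [Field K] [NumberField K] (α β : K)
    (hα : α ^ 2 = ((q₁ * q₂ : ℕ) : K)) (hβ : β ^ 2 = ((p₁ * p₂ * p₃ : ℕ) : K))
    (hK : IntermediateField.adjoin ℚ {α, β} = ⊤) :
    -- `legendreSym p a` is the Legendre symbol `(a / p)`
    (legendreSym p₂ p₁ = 1 ∧ legendreSym p₃ p₁ = 1 ∧ legendreSym p₃ p₂ = -1 ∧
        legendreSym q₁ p₃ = -1 ∧ legendreSym q₂ p₃ = -1 ∧
        legendreSym q₁ p₁ = -1 ∧ legendreSym q₂ p₁ = -1 ∧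
        legendreSym p₂ (q₁ * q₂) = -1 →
      IsPolyaField K) ∧
    (legendreSym p₂ p₁ = 1 ∧ legendreSym p₃ p₁ = -1 ∧ legendreSym p₃ p₂ = 1 ∧
        legendreSym q₁ p₃ = -1 ∧ legendreSym q₂ p₃ = -1 ∧
        legendreSym q₁ p₁ = 1 ∧ legendreSym q₂ p₁ = 1 ∧
        legendreSym p₂ (q₁ * q₂) = -1 →
      IsPolyaField K) ∧
    (legendreSym p₃ p₁ = -1 ∧ legendreSym p₃ p₂ = -1 ∧
        legendreSym q₁ p₃ = 1 ∧ legendreSym q₂ p₃ = -1 ∧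
        legendreSym q₁ (p₁ * p₂) = -1 ∧ legendreSym q₂ (p₁ * p₂) = -1 ∧
        legendreSym p₁ (q₁ * q₂) = 1 →
      IsPolyaField K) ∧
    (legendreSym p₂ p₁ = -1 ∧ legendreSym p₃ p₁ = 1 ∧ legendreSym p₃ p₂ = -1 ∧
        legendreSym q₁ p₃ = -1 ∧ legendreSym q₂ p₃ = -1 ∧
        legendreSym q₁ (p₁ * p₂) = 1 ∧ legendreSym q₂ (p₁ * p₂) = 1 ∧
        legendreSym p₁ (q₁ * q₂) = -1 →
      IsPolyaField K) ∧
    (legendreSym p₂ p₁ = -1 ∧ legendreSym p₃ p₁ = -1 ∧ legendreSym p₃ p₂ = 1 ∧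
        legendreSym q₁ p₃ = -1 ∧ legendreSym q₂ p₃ = -1 ∧
        legendreSym q₁ p₁ = -1 ∧ legendreSym q₂ p₁ = -1 ∧
        legendreSym p₂ (q₁ * q₂) = -1 →
      IsPolyaField K) ∧
    (legendreSym p₃ p₁ = 1 ∧ legendreSym p₃ p₂ = 1 →
      IsPolyaField K ∨ Nonempty (polyaGroup K ≃* Multiplicative (ZMod 2))) := by
  obtain ⟨h₁, h₂₅, h₃, h₄, h₆⟩ :=
    theorem1_general p₁ p₂ p₃ q₁ q₂ hdistinct hp₁ hp₂ hq₁ hq₂ hp₃ K α β hα hβ hK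
  exact ⟨h₁, by grind, h₃, by grind, by grind, fun _ => h₆⟩
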